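/- **Definitions.** For a potential $F(x_1,x_2,x_3,x_4)$ with weights $(w_1,w_2,w_3,w_4)$, $w_4=1$, let $E=\sum_k w_kx_k\partial_{x_k}$, let $C$ be the matrix $C_{ij}=\partial_{x_i}\partial_{x_{5-j}}F$, let $T=EC$ ($E$ applied entrywise), and let $\Delta_F=\det T$. The polynomial $H_4$ potential, with weights $(\frac1{15},\frac25,\frac23,1)$, is $$F_{H_4(0)}=\frac{x_{1}x_{4}^{2}}{2}+x_{2}x_{3}x_{4}+\frac{32x_{1}^{31}}{22395255890625}+\frac{2x_{1}^{19}x_{2}^{2}}{15582375}+\frac{x_{1}^{13}x_{2}^{3}}{72900}+\frac{8x_{1}^{11}x_{3}^{2}}{22275}+\frac{1}{810}x_{1}^{9}x_{2}^{2}x_{3}+\frac{x_{1}^{7}x_{2}^{4}}{1080}+\frac{1}{15}x_{1}^{5}x_{2}x_{3}^{2}+\frac{1}{18}x_{1}^{3}x_{2}^{3}x_{3}+\frac{x_{1}x_{2}^{5}}{240}+\frac{2x_{1}x_{3}^{3}}{3}.$$ The algebraic potential of type $H_4(1)$, with weights $(\frac1{10},\frac12,\frac35,1)$, is $$F_{H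_4(1)}=x_{2}x_{3}x_{4}+\frac{1}{2}x_{1}x_{4}^{2}+\frac{4}{13167}x_{1}(51139x_{1}^{20}-175560x_{1}^{15}x_{2}-95760x_{1}^{10}x_{2}^{2}+1790712x_{1}^{5}x_{2}^{3}-13167x_{2}^{4})-\frac{4}{45}(17x_{1}^{15}+75x_{1}^{10}x_{2}-900x_{1}^{5}x_{2}^{2}+30x_{2}^{3})z^{2}-\frac{1}{18}x_{1}^{4}(17x_{1}^{5}-90x_{2})z^{4}+\frac{1}{6}x_{1}^{3}z^{6}+\frac{1}{105}z^{7},$$ where $z$ is the algebraic function of $(x_1,x_2,x_3)$ defined by $z^2=x_3+4x_1(x_1^5-3x_2)$. Write $\Delta_{H_4(j)}=\det T$ for $F=F_{H_4(j)}$. Consider the families of surfaces $z^2=f_{H_4(j)}(x,y)$ in $\mathbb C^3$ with $$f_{H_4(0)}=x^{5}+t_{15}+5t_{6}^{2}x+5t_{6}x^{3}+y(10t_{1}t_{6}x+5t_{1}x^{3}+t_{10})+5t_{1}^{2}xy^{2}+y^{3},$$ $$f_{H_4(1)}=x(5t_{3}^{2}+5t_{3}x+x^{2})^{2}+y(5t_{1}(t_{3}+x)(5t_{3}^{2}+5t_{3}x+x^{2})+t_{10})+y^{2}(5t_{1}^{2}x+t_{5})+y^{3},$$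 with parameters $(t_1,t_6,t_{10},t_{15})\in\mathbb C^4$ and $(t_1,t_3,t_5,t_{10})\in\mathbb C^4$ respectively. The discriminant locus of a family is the set of parameters for which the surface has a singular point, and its discriminant is a square-free polynomial with zero set the discriminant locus (unique up to a nonzero constant factor). Put $$D_{H_4(0)}=-3125t_{1}^{12}t_{10}^{3}t_{6}^{3}-27t_{1}^{10}t_{10}^{5}-9375t_{1}^{10}t_{10}^{2}t_{6}^{5}-105t_{1}^{8}t_{10}^{4}t_{6}^{2}-9375t_{1}^{8}t_{10}t_{6}^{7}+13695t_{1}^{6}t_{10}^{3}t_{6}^{4}-3125t_{1}^{6}t_{6}^{9}+120t_{1}^{4}t_{10}^{5}t_{6}+36885t_{1}^{4}t_{10}^{2}t_{6}^{6}+2280t_{1}^{2}t_{10}^{4}t_{6}^{3}+35640t_{1}^{2}t_{10}t_{6}^{8}+16t_{10}^{6}-864t_{10}^{3}t_{6}^{5}+11664t_{6}^{10}+3t_{1}t_{15}(3125t_{1}^{12}t_{10}^{2}t_{6}^{2}+6250t_{1}^{10}t_{10}t_{6}^{4}+25t_{1}^{8}t_{10}^{3}t_{6}+3125t_{1}^{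8}t_{6}^{6}-14150t_{1}^{6}t_{10}^{2}t_{6}^{3}-4t_{1}^{4}t_{10}^{4}-24075t_{1}^{4}t_{10}t_{6}^{5}-1980t_{1}^{2}t_{10}^{3}t_{6}^{2}-11700t_{1}^{2}t_{6}^{7}+4320t_{10}^{2}t_{6}^{4})-3t_{15}^{2}(3125t_{1}^{14}t_{10}t_{6}+3125t_{1}^{12}t_{6}^{3}+125t_{1}^{10}t_{10}^{2}-14625t_{1}^{8}t_{10}t_{6}^{2}-11250t_{1}^{6}t_{6}^{4}-2430t_{1}^{4}t_{10}^{2}t_{6}+7830t_{1}^{2}t_{10}t_{6}^{3}-72t_{10}^{3}-1944t_{6}^{5})+25t_{1}^{3}t_{15}^{3}(125t_{1}^{12}-675t_{1}^{6}t_{6}-81t_{1}^{2}t_{10}+729t_{6}^{2})+729t_{15}^{4},$$ $$D_{H_4(1)}=t_{3}^{5}(25t_{1}^{2}t_{3}-4t_{5})^{2}(125t_{1}^{9}t_{3}^{2}-25t_{1}^{7}t_{3}t_{5}-1225t_{1}^{6}t_{3}^{3}+t_{1}^{5}t_{5}^{2}+370t_{1}^{4}t_{3}^{2}t_{5}+3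35t_{1}^{3}t_{3}^{4}-35t_{1}^{2}t_{3}t_{5}^{2}-45t_{1}t_{3}^{3}t_{5}-27t_{3}^{5}+t_{5}^{3})-t_{3}^{3}(10625t_{1}^{12}t_{3}^{3}-4750t_{1}^{10}t_{3}^{2}t_{5}-91750t_{1}^{9}t_{3}^{4}+605t_{1}^{8}t_{3}t_{5}^{2}+54350t_{1}^{7}t_{3}^{3}t_{5}-83175t_{1}^{6}t_{3}^{5}-20t_{1}^{6}t_{5}^{3}-10548t_{1}^{5}t_{3}^{2}t_{5}^{2}+25600t_{1}^{4}t_{3}^{4}t_{5}+22520t_{1}^{3}t_{3}^{6}+805t_{1}^{3}t_{3}t_{5}^{3}-2930t_{1}^{2}t_{3}^{3}t_{5}^{2}-2880t_{1}t_{3}^{5}t_{5}-20t_{1}t_{5}^{4}-1728t_{3}^{7}+136t_{3}^{2}t_{5}^{3})t_{10}+(-1225t_{1}^{11}t_{3}^{3}+255t_{1}^{9}t_{3}^{2}t_{5}+13895t_{1}^{8}t_{3}^{4}-30t_{1}^{7}t_{3}t_{5}^{2}-3900t_{1}^{6}t_{3}^{3}t_{5}-19976t_{1}^{5}t_{3}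^{5}+t_{1}^{5}t_{5}^{3}+550t_{1}^{4}t_{3}^{2}t_{5}^{2}+3700t_{1}^{3}t_{3}^{4}t_{5}+840t_{1}^{2}t_{3}^{6}-40t_{1}^{2}t_{3}t_{5}^{3}-200t_{1}t_{3}^{3}t_{5}^{2}+288t_{3}^{5}t_{5}+t_{5}^{4})t_{10}^{2}+(-27t_{1}^{10}+360t_{1}^{7}t_{3}-36t_{1}^{5}t_{5}-920t_{1}^{4}t_{3}^{2}+160t_{1}^{2}t_{3}t_{5}+480t_{1}t_{3}^{3}-8t_{5}^{2})t_{10}^{3}+16t_{10}^{4}.$$ **Theorem.** (i) The discriminant of the family $z^2=f_{H_4(0)}$ is $D_{H_4(0)}$. The formulas $$x_1=t_{1},\quad x_2=\frac{4}{225}(10t_{1}^{6}-27t_{6}),\quad x_3=\frac{2}{50625}(500t_{1}^{10}-2025t_{1}^{4}t_{6}-486t_{10}),\quad x_4=\frac{8}{11390625}(8125t_{1}^{15}-47250t_{1}^{9}t_{6}-7290t_{1}^{5}t_{10}+54675t_{1}^{3}t_{6}^{2}+13122t_{15})$$ define a bijective change of coordinates $\mathbb C^4\to\mathbb C^4$,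 under which $\Delta_{H_4(0)}$ coincides with $D_{H_4(0)}$ up to a nonzero constant factor. (ii) The discriminant of the family $z^2=f_{H_4(1)}$ is $t_{10}D_{H_4(1)}$. A holomorphic branch of $z$ exists near every point of the double cover $z^2=x_3+4x_1(x_1^5-3x_2)$ with $z\ne0$; for all holomorphic branches, $\Delta_{H_4(1)}$ is one and the same polynomial in $(x_1,x_2,z,x_4)$. The formulas $$x_1=t_{1},\quad x_2=\frac{1}{5}(17t_{1}^{5}-160t_{1}^{2}t_{3}+16t_{5}),\quad z=16t_{3},\quad x_4=\frac{8}{25}(987t_{1}^{10}-15120t_{1}^{7}t_{3}+1512t_{1}^{5}t_{5}+50400t_{1}^{4}t_{3}^{2}-8960t_{1}^{2}t_{3}t_{5}-12800t_{1}t_{3}^{3}-2560t_{10}+448t_{5}^{2})$$ define a bijective change of coordinates $\mathbb C^4\to\mathbb C^4$, $(t_1,t_3,t_5,t_{10})\mapsto(x_1,x_2,z,x_4)$, under which the polynomial $\Delta_{H_4(1)}$ coincides with $D_{H_4(1)}$ up to a nonzero constant factor. (iii) Put $$u_1=t_{1},\quad u_6=\frac{1}{3}(10t_{1}^{3}t_{3}-t_{1}t_{5}-3t_{3}^{2}),\quad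 u_{10}=\frac{1}{3}(-100t_{1}^{4}t_{3}^{2}+20t_{1}^{2}t_{3}t_{5}+15t_{1}t_{3}^{3}+3t_{10}-t_{5}^{2}),\quad u_{15}=\frac{1}{27}(-2000t_{1}^{6}t_{3}^{3}+600t_{1}^{4}t_{3}^{2}t_{5}+450t_{1}^{3}t_{3}^{4}+90t_{1}^{2}t_{10}t_{3}-60t_{1}^{2}t_{3}t_{5}^{2}-45t_{1}t_{3}^{3}t_{5}-9t_{10}t_{5}-54t_{3}^{5}+2t_{5}^{3}).$$ Then, with $x=x'-2t_3$ and $y=y'+\frac13(10t_1^2t_3-t_5)$, the polynomial $f_{H_4(1)}(x,y)$ with parameters $(t_1,t_3,t_5,t_{10})$ equals $f_{H_4(0)}(x',y')$ with parameters $(u_1,u_6,u_{10},u_{15})$, and $$D_{H_4(0)}(u_1,u_6,u_{10},u_{15})=t_{10}^2\,D_{H_4(1)}(t_1,t_3,t_5,t_{10}).$$ -/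

import Mathlib

noncomputable section

namespace H4Family

open MvPolynomial

/-! ## The discriminant `det T` of a potential in four flat coordinates -/

/-- Partial derivative `∂F/∂x_{j+1}` of a function on `ℂ⁴`. -/
def pd (j : Fin 4) (F : (Fin 4 → ℂ) → ℂ) : (Fin 4 → ℂ) → ℂ :=
  fun x => fderiv ℂ F x (Pi.single j 1)

/-- The Euler vector field `E = (1 / w₄) ∑ₖ wₖ xₖ ∂ₖ` applied to `F`. -/
def euler (w : Fin 4 → ℂ) (F : (Fin 4 → ℂ) → ℂ) : (Fin 4 → ℂ) → ℂ :=
  fun x => 1 / w 3 * ∑ k, w k * x k * pd k F x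

/-- The matrix `C`, whose `i`-th row is `∂ᵢ P` for the gradient `P = (∂₄F, ∂₃F, ∂₂F, ∂₁F)`. -/
def hessC (F : (Fin 4 → ℂ) → ℂ) (i j : Fin 4) : (Fin 4 → ℂ) → ℂ :=
  pd i (pd (Fin.rev j) F)

/-- The matrix `T = E C` at the point `x`. -/
def matT (w : Fin 4 → ℂ) (F : (Fin 4 → ℂ) → ℂ) (x : Fin 4 → ℂ) : Matrix (Fin 4) (Fin 4) ℂ :=
  Matrix.of fun i j => euler w (hessC F i j) x

/-- The discriminant `Δ_F = det T` of the potential `F` at the point `x`. -/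
def discr (w : Fin 4 → ℂ) (F : (Fin 4 → ℂ) → ℂ) (x : Fin 4 → ℂ) : ℂ :=
  (matT w F x).det

/-! ## The two potentials; `x = (x₁, x₂, x₃, x₄)` -/

/-- Weights of the flat coordinates of the polynomial potential of type `H₄`. -/
def wH4Zero : Fin 4 → ℂ := ![1 / 15, 2 / 5, 2 / 3, 1]

/-- The polynomial potential of type `H₄`. -/
def potH4Zero (x : Fin 4 → ℂ) : ℂ :=
  x 0 * x 3 ^ 2 / 2 + x 1 * x 2 * x 3 + 32 * x 0 ^ 31 / 22395255890625 +
    2 * x 0 ^ 19 * x 1 ^ 2 / 15582375 + x 0 ^ 13 * x 1 ^ 3 / 72900 + 8 * x 0 ^ 11 * x 2 ^ 2 /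
    22275 + 1 / 810 * x 0 ^ 9 * x 1 ^ 2 * x 2 + x 0 ^ 7 * x 1 ^ 4 / 1080 + 1 /
    15 * x 0 ^ 5 * x 1 * x 2 ^ 2 + 1 / 18 * x 0 ^ 3 * x 1 ^ 3 * x 2 + x 0 * x 1 ^ 5 / 240 +
    2 * x 0 * x 2 ^ 3 / 3

/-- Weights of the flat coordinates of the algebraic potential `H₄(1)`. -/
def wH4One : Fin 4 → ℂ := ![1 / 10, 1 / 2, 3 / 5, 1]

/-- `z` is a holomorphic branch on the open set `U ⊆ ℂ⁴` of the algebraic function defined by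
`-4 x₁ (x₁⁵ - 3 x₂) - x₃ + z² = 0`. -/
def IsBranch (U : Set (Fin 4 → ℂ)) (z : (Fin 4 → ℂ) → ℂ) : Prop :=
  IsOpen U ∧ DifferentiableOn ℂ z U ∧
    ∀ x ∈ U, -4 * x 0 * (x 0 ^ 5 - 3 * x 1) - x 2 + z x ^ 2 = 0

/-- The algebraic potential `H₄(1)`, as a function of `x` for a branch `z`. -/
def potH4One (z : (Fin 4 → ℂ) → ℂ) (x : Fin 4 → ℂ) : ℂ :=
  x 1 * x 2 * x 3 + 1 / 2 * x 0 * x 3 ^ 2 + 4 / 13167 * x 0 * (51139 * x 0 ^ 20 -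
    175560 * x 0 ^ 15 * x 1 - 95760 * x 0 ^ 10 * x 1 ^ 2 + 1790712 * x 0 ^ 5 * x 1 ^ 3 -
    13167 * x 1 ^ 4) - 4 / 45 * (17 * x 0 ^ 15 + 75 * x 0 ^ 10 * x 1 - 900 * x 0 ^ 5 * x 1 ^ 2
    + 30 * x 1 ^ 3) * z x ^ 2 - 1 / 18 * x 0 ^ 4 * (17 * x 0 ^ 5 - 90 * x 1) * z x ^ 4 + 1 /
    6 * x 0 ^ 3 * z x ^ 6 + 1 / 105 * z x ^ 7

/-- The point `x` of `ℂ⁴` that lies below the point `s = (x₁, x₂, z, x₄)` of the double cover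
`z² = x₃ + 4 x₁ (x₁⁵ - 3 x₂)`. -/
def basePoint (s : Fin 4 → ℂ) : Fin 4 → ℂ :=
  ![s 0, s 1, s 2 ^ 2 - 4 * s 0 * (s 0 ^ 5 - 3 * s 1), s 3]

/-! ## Families of surfaces `z² = f(x, y)` and their discriminants -/

/-- The equation `z² - f(x, y)` in the variables `(x, y, z)`. -/
def surface (f : MvPolynomial (Fin 2) ℂ) : MvPolynomial (Fin 3) ℂ :=
  X 2 ^ 2 - rename Fin.castSucc f

/-- The hypersurface `G = 0` of `ℂ³` has a singular point. -/
def IsSingularSurface (G : MvPolynomial (Fin 3) ℂ) : Prop :=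
  ∃ p : Fin 3 → ℂ, eval p G = 0 ∧ ∀ i, eval p (pderiv i G) = 0

/-- The discriminant locus of the family `z² = f t (x, y)`. -/
def discriminantLocus (f : (Fin 4 → ℂ) → MvPolynomial (Fin 2) ℂ) : Set (Fin 4 → ℂ) :=
  {t | IsSingularSurface (surface (f t))}

/-- `δ` is a discriminant of the family `z² = f t (x, y)`: a reduced equation of the
discriminant locus. It is unique up to a nonzero constant factor. -/
def IsDiscriminant (f : (Fin 4 → ℂ) → MvPolynomial (Fin 2) ℂ) (δ : MvPolynomial (Fin 4) ℂ) :
    Prop :=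
  Squarefree δ ∧ discriminantLocus f = {t | eval t δ = 0}

/-! ### The family of type `H₄(0)`; `t = (t₁, t₆, t₁₀, t₁₅)` -/

def exprFH4Zero {R : Type*} [CommRing R] (t1 t6 t10 t15 x y : R) : R :=
  x ^ 5 + t15 + 5 * t6 ^ 2 * x + 5 * t6 * x ^ 3 + y * (10 * t1 * t6 * x + 5 * t1 * x ^ 3 +
    t10) + 5 * t1 ^ 2 * x * y ^ 2 + y ^ 3

def fH4Zero (t : Fin 4 → ℂ) : MvPolynomial (Fin 2) ℂ :=
  exprFH4Zero (C (t 0)) (C (t 1)) (C (t 2)) (C (t 3)) (X 0) (X 1)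

def exprDH4Zero {R : Type*} [CommRing R] (t1 t6 t10 t15 : R) : R :=
  -3125 * t1 ^ 12 * t10 ^ 3 * t6 ^ 3 - 27 * t1 ^ 10 * t10 ^ 5 -
    9375 * t1 ^ 10 * t10 ^ 2 * t6 ^ 5 - 105 * t1 ^ 8 * t10 ^ 4 * t6 ^ 2 -
    9375 * t1 ^ 8 * t10 * t6 ^ 7 + 13695 * t1 ^ 6 * t10 ^ 3 * t6 ^ 4 - 3125 * t1 ^ 6 * t6 ^ 9
    + 120 * t1 ^ 4 * t10 ^ 5 * t6 + 36885 * t1 ^ 4 * t10 ^ 2 * t6 ^ 6 +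
    2280 * t1 ^ 2 * t10 ^ 4 * t6 ^ 3 + 35640 * t1 ^ 2 * t10 * t6 ^ 8 + 16 * t10 ^ 6 -
    864 * t10 ^ 3 * t6 ^ 5 + 11664 * t6 ^ 10 +
    3 * t1 * t15 * (3125 * t1 ^ 12 * t10 ^ 2 * t6 ^ 2 + 6250 * t1 ^ 10 * t10 * t6 ^ 4 +
    25 * t1 ^ 8 * t10 ^ 3 * t6 + 3125 * t1 ^ 8 * t6 ^ 6 - 14150 * t1 ^ 6 * t10 ^ 2 * t6 ^ 3 -
    4 * t1 ^ 4 * t10 ^ 4 - 24075 * t1 ^ 4 * t10 * t6 ^ 5 - 1980 * t1 ^ 2 * t10 ^ 3 * t6 ^ 2 -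
    11700 * t1 ^ 2 * t6 ^ 7 + 4320 * t10 ^ 2 * t6 ^ 4) -
    3 * t15 ^ 2 * (3125 * t1 ^ 14 * t10 * t6 + 3125 * t1 ^ 12 * t6 ^ 3 +
    125 * t1 ^ 10 * t10 ^ 2 - 14625 * t1 ^ 8 * t10 * t6 ^ 2 - 11250 * t1 ^ 6 * t6 ^ 4 -
    2430 * t1 ^ 4 * t10 ^ 2 * t6 + 7830 * t1 ^ 2 * t10 * t6 ^ 3 - 72 * t10 ^ 3 -
    1944 * t6 ^ 5) + 25 * t1 ^ 3 * t15 ^ 3 * (125 * t1 ^ 12 - 675 * t1 ^ 6 * t6 -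
    81 * t1 ^ 2 * t10 + 729 * t6 ^ 2) + 729 * t15 ^ 4

/-- The polynomial `D_{H₄(0)}(t₁, t₆, t₁₀, t₁₅)`. -/
def polyDH4Zero : MvPolynomial (Fin 4) ℂ :=
  exprDH4Zero (X 0) (X 1) (X 2) (X 3)

/-- The coordinate change `(t₁, t₆, t₁₀, t₁₅) ↦ (x₁, x₂, x₃, x₄)`. -/
def coordH4Zero (t : Fin 4 → ℂ) : Fin 4 → ℂ :=
  ![
    t 0,
    4 / 225 * (10 * t 0 ^ 6 - 27 * t 1),
    2 / 50625 * (500 * t 0 ^ 10 - 2025 * t 0 ^ 4 * t 1 - 486 * t 2),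
    8 / 11390625 * (8125 * t 0 ^ 15 - 47250 * t 0 ^ 9 * t 1 - 7290 * t 0 ^ 5 * t 2 +
      54675 * t 0 ^ 3 * t 1 ^ 2 + 13122 * t 3)]

/-! ### The family of type `H₄(1)`; `t = (t₁, t₃, t₅, t₁₀)` -/

def exprFH4One {R : Type*} [CommRing R] (t1 t3 t5 t10 x y : R) : R :=
  x * (5 * t3 ^ 2 + 5 * t3 * x + x ^ 2) ^ 2 + y * (5 * t1 * (t3 + x) * (5 * t3 ^ 2 +
    5 * t3 * x + x ^ 2) + t10) + y ^ 2 * (5 * t1 ^ 2 * x + t5) + y ^ 3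

def fH4One (t : Fin 4 → ℂ) : MvPolynomial (Fin 2) ℂ :=
  exprFH4One (C (t 0)) (C (t 1)) (C (t 2)) (C (t 3)) (X 0) (X 1)

def exprDH4One {R : Type*} [CommRing R] (t1 t3 t5 t10 : R) : R :=
  t3 ^ 5 * (25 * t1 ^ 2 * t3 - 4 * t5) ^ 2 * (125 * t1 ^ 9 * t3 ^ 2 - 25 * t1 ^ 7 * t3 * t5 -
    1225 * t1 ^ 6 * t3 ^ 3 + t1 ^ 5 * t5 ^ 2 + 370 * t1 ^ 4 * t3 ^ 2 * t5 +
    335 * t1 ^ 3 * t3 ^ 4 - 35 * t1 ^ 2 * t3 * t5 ^ 2 - 45 * t1 * t3 ^ 3 * t5 - 27 * t3 ^ 5 +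
    t5 ^ 3) - t3 ^ 3 * (10625 * t1 ^ 12 * t3 ^ 3 - 4750 * t1 ^ 10 * t3 ^ 2 * t5 -
    91750 * t1 ^ 9 * t3 ^ 4 + 605 * t1 ^ 8 * t3 * t5 ^ 2 + 54350 * t1 ^ 7 * t3 ^ 3 * t5 -
    83175 * t1 ^ 6 * t3 ^ 5 - 20 * t1 ^ 6 * t5 ^ 3 - 10548 * t1 ^ 5 * t3 ^ 2 * t5 ^ 2 +
    25600 * t1 ^ 4 * t3 ^ 4 * t5 + 22520 * t1 ^ 3 * t3 ^ 6 + 805 * t1 ^ 3 * t3 * t5 ^ 3 -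
    2930 * t1 ^ 2 * t3 ^ 3 * t5 ^ 2 - 2880 * t1 * t3 ^ 5 * t5 - 20 * t1 * t5 ^ 4 -
    1728 * t3 ^ 7 + 136 * t3 ^ 2 * t5 ^ 3) * t10 + (-1225 * t1 ^ 11 * t3 ^ 3 +
    255 * t1 ^ 9 * t3 ^ 2 * t5 + 13895 * t1 ^ 8 * t3 ^ 4 - 30 * t1 ^ 7 * t3 * t5 ^ 2 -
    3900 * t1 ^ 6 * t3 ^ 3 * t5 - 19976 * t1 ^ 5 * t3 ^ 5 + t1 ^ 5 * t5 ^ 3 +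
    550 * t1 ^ 4 * t3 ^ 2 * t5 ^ 2 + 3700 * t1 ^ 3 * t3 ^ 4 * t5 + 840 * t1 ^ 2 * t3 ^ 6 -
    40 * t1 ^ 2 * t3 * t5 ^ 3 - 200 * t1 * t3 ^ 3 * t5 ^ 2 + 288 * t3 ^ 5 * t5 +
    t5 ^ 4) * t10 ^ 2 + (-27 * t1 ^ 10 + 360 * t1 ^ 7 * t3 - 36 * t1 ^ 5 * t5 -
    920 * t1 ^ 4 * t3 ^ 2 + 160 * t1 ^ 2 * t3 * t5 + 480 * t1 * t3 ^ 3 - 8 * t5 ^ 2) * t10 ^ 3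
    + 16 * t10 ^ 4

/-- The polynomial `D_{H₄(1)}(t₁, t₃, t₅, t₁₀)`. -/
def polyDH4One : MvPolynomial (Fin 4) ℂ :=
  exprDH4One (X 0) (X 1) (X 2) (X 3)

/-- The coordinate change `(t₁, t₃, t₅, t₁₀) ↦ (x₁, x₂, z, x₄)` to the double cover. -/
def coordH4One (t : Fin 4 → ℂ) : Fin 4 → ℂ :=
  ![
    t 0,
    1 / 5 * (17 * t 0 ^ 5 - 160 * t 0 ^ 2 * t 1 + 16 * t 2),
    16 * t 1,
    8 / 25 * (987 * t 0 ^ 10 - 15120 * t 0 ^ 7 * t 1 + 1512 * t 0 ^ 5 * t 2 +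
      50400 * t 0 ^ 4 * t 1 ^ 2 - 8960 * t 0 ^ 2 * t 1 * t 2 - 12800 * t 0 * t 1 ^ 3 -
      2560 * t 3 + 448 * t 2 ^ 2)]

/-- The substitution `(t₁, t₃, t₅, t₁₀) ↦ (u₁, u₆, u₁₀, u₁₅)` relating the two families. -/
def substU (t : Fin 4 → ℂ) : Fin 4 → ℂ :=
  ![
    t 0,
    1 / 3 * (10 * t 0 ^ 3 * t 1 - t 0 * t 2 - 3 * t 1 ^ 2),
    1 / 3 * (-100 * t 0 ^ 4 * t 1 ^ 2 + 20 * t 0 ^ 2 * t 1 * t 2 + 15 * t 0 * t 1 ^ 3 +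
      3 * t 3 - t 2 ^ 2),
    1 / 27 * (-2000 * t 0 ^ 6 * t 1 ^ 3 + 600 * t 0 ^ 4 * t 1 ^ 2 * t 2 +
      450 * t 0 ^ 3 * t 1 ^ 4 + 90 * t 0 ^ 2 * t 3 * t 1 - 60 * t 0 ^ 2 * t 1 * t 2 ^ 2 -
      45 * t 0 * t 1 ^ 3 * t 2 - 9 * t 3 * t 2 - 54 * t 1 ^ 5 + 2 * t 2 ^ 3)]

end H4Family

end

open H4Family MvPolynomial

/-!
A singular point of `z² = f(x, y)` is a common zero of `f`, `f_x`, `f_y`. For `H₄(0)`, once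
`w = t₁y + t₆` is written as `-s²`, the polynomial `f` is `D₅(x, s²) + y³ + t₁₀ y + t₁₅` with the
Dickson polynomial `D₅`, whose critical values are `±2s⁵`. The class of `f` in the Jacobian algebra
`ℂ[x, y] / (f_x, f_y)` lies in the subalgebra of rank 4 generated by `y` and `σ = x³ + 2wx`, which
equals `±s³` at the critical points of `D₅`. So `f` vanishes at a common zero of `f_x` and `f_y` if
and only if multiplication by `f` on this subalgebra has determinant zero, and this determinant is
`D_{H₄(0)} / 729`. That `D_{H₄(0)}` is square-free is seen by specialising all parameters but
`t₁₅`, in which its leading coefficient is constant.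

The derivatives of `f` by `t₁₅, t₁₀, t₆, t₁` are `1, y, 5σ, 5σy`, and `1, y, σ, σy` is a basis of
the subalgebra. Through this identification of tangent vectors with elements of the subalgebra, the
matrix `T` of the flat potential is a constant multiple of the matrix of multiplication by `f`, so
`Δ` is a constant multiple of `D_{H₄(0)}`.

The family of type `H₄(1)` is, up to a translation of `x` and `y`, the pullback of the one of type
`H₄(0)` along `t ↦ u`, so its discriminant is read off from `D_{H₄(0)}(u) = t₁₀² D_{H₄(1)}(t)`. On a
branch of `z` the potential is a polynomial in `x` plus `z⁷ / 105`, and `z²` is a polynomial, so the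
second derivatives, and with them the entries of `T`, have the form `P(x) + z³ R(x)`.
-/

noncomputable section

namespace H4Family

section CommonEigenvectors

variable {K V n : Type*} [Field K] [IsAlgClosed K] [AddCommGroup V] [Module K V]
  [FiniteDimensional K V]

theorem exists_eigenvector_mem (f : Module.End K V) {W : Submodule K V} (hW : W ≠ ⊥)
    (hf : ∀ v ∈ W, f v ∈ W) : ∃ a : K, ∃ v ∈ W, v ≠ 0 ∧ f v = a • v := by
  have : Nontrivial W := Submodule.nontrivial_iff_ne_bot.mpr hW
  obtain ⟨a, ha⟩ := Module.End.exists_eigenvalue (f.restrict hf)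
  obtain ⟨v, hv⟩ := ha.exists_hasEigenvector
  exact ⟨a, v, v.2, fun h => hv.2 (Subtype.ext h), congrArg Subtype.val hv.apply_eq_smul⟩

theorem exists_common_eigenvector_mem {f g : Module.End K V} (hfg : Commute f g)
    {W : Submodule K V} (hW : W ≠ ⊥) (hf : ∀ v ∈ W, f v ∈ W) (hg : ∀ v ∈ W, g v ∈ W) :
    ∃ a b : K, ∃ v ∈ W, v ≠ 0 ∧ f v = a • v ∧ g v = b • v := by
  obtain ⟨a, v, hvW, hv0, hfv⟩ := exists_eigenvector_mem f hW hf
  have hWa : W ⊓ f.eigenspace a ≠ ⊥ :=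
    (Submodule.ne_bot_iff _).mpr ⟨v, ⟨hvW, Module.End.mem_eigenspace_iff.mpr hfv⟩, hv0⟩
  have hgWa : ∀ u ∈ W ⊓ f.eigenspace a, g u ∈ W ⊓ f.eigenspace a := fun u ⟨huW, hua⟩ =>
    ⟨hg u huW, Module.End.mapsTo_genEigenspace_of_comm hfg a 1 hua⟩
  obtain ⟨b, w, ⟨hwW, hwa⟩, hw0, hgw⟩ := exists_eigenvector_mem g hWa hgWa
  exact ⟨a, b, w, hwW, hw0, Module.End.mem_eigenspace_iff.mp hwa, hgw⟩

theorem exists_common_eigenvector_of_det_eq_zero [Fintype n] [DecidableEq n]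
    {A B N : Matrix n n K} (hAB : Commute A B) (hAN : Commute A N) (hBN : Commute B N)
    (hN : N.det = 0) :
    ∃ a b : K, ∃ v : n → K, v ≠ 0 ∧ A.mulVec v = a • v ∧ B.mulVec v = b • v ∧
      N.mulVec v = 0 := by
  obtain ⟨v, hv0, hv⟩ := Matrix.exists_mulVec_eq_zero_iff.mpr hN
  have ker_ne_bot : LinearMap.ker N.mulVecLin ≠ ⊥ := (Submodule.ne_bot_iff _).mpr ⟨v, hv, hv0⟩
  have mulVec_mem_ker {M : Matrix n n K} (hM : Commute M N) (u : n → K)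
      (hu : u ∈ LinearMap.ker N.mulVecLin) : M.mulVecLin u ∈ LinearMap.ker N.mulVecLin := by
    rw [LinearMap.mem_ker, Matrix.mulVecLin_apply] at *
    rw [Matrix.mulVecLin_apply, Matrix.mulVec_mulVec, ← hM.eq, ← Matrix.mulVec_mulVec, hu,
      Matrix.mulVec_zero]
  have commute_mulVecLin : Commute A.mulVecLin B.mulVecLin := by
    rw [commute_iff_eq, Module.End.mul_eq_comp, Module.End.mul_eq_comp, ← Matrix.mulVecLin_mul,
      ← Matrix.mulVecLin_mul, hAB.eq]
  obtain ⟨a, b, w, hw, hw0, hAw, hBw⟩ := exists_common_eigenvector_mem commute_mulVecLin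
    ker_ne_bot (mulVec_mem_ker hAN) (mulVec_mem_ker hBN)
  exact ⟨a, b, w, hw0, hAw, hBw, hw⟩

end CommonEigenvectors

section Squarefree

variable {K : Type*} [Field K]

theorem squarefree_of_squarefree_map {R : Type*} [CommRing R] [IsDomain R] (φ : R →+* K)
    {f : Polynomial R} (hf : IsUnit f.leadingCoeff) (hsq : Squarefree (f.map φ)) :
    Squarefree f := by
  rintro p ⟨q, rfl⟩
  have hp : IsUnit p.leadingCoeff := by
    rw [Polynomial.leadingCoeff_mul, Polynomial.leadingCoeff_mul] at hf
    exact isUnit_of_mul_isUnit_left (isUnit_of_mul_isUnit_left hf)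
  have hpφ : IsUnit (p.map φ) := hsq _ ⟨q.map φ, by simp only [Polynomial.map_mul]⟩
  have hdeg : p.natDegree = 0 := by
    rw [← Polynomial.natDegree_map_of_leadingCoeff_ne_zero φ (hp.map φ).ne_zero]
    exact Polynomial.natDegree_eq_zero_of_isUnit hpφ
  rw [Polynomial.leadingCoeff, hdeg] at hp
  rw [Polynomial.eq_C_of_natDegree_eq_zero hdeg]
  exact Polynomial.isUnit_C.mpr hp

theorem squarefree_C_mul_prod_X_sub_C {ι : Type*} [Fintype ι] {c : K} (hc : c ≠ 0) {r : ι → K}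
    (hr : Function.Injective r) :
    Squarefree (Polynomial.C c * ∏ i, (Polynomial.X - Polynomial.C (r i))) :=
  ((Polynomial.separable_prod_X_sub_C_iff.mpr hr).unit_mul
    (Polynomial.isUnit_C.mpr hc.isUnit)).squarefree

/-- A polynomial in `n + 1` variables, viewed as a univariate polynomial in the last variable
over the polynomials in the first `n`; `finSuccEquiv` singles out the first variable instead. -/
def lastVariable (R : Type*) [CommSemiring R] (n : ℕ) :
    MvPolynomial (Fin (n + 1)) R ≃ₐ[R] Polynomial (MvPolynomial (Fin n) R) :=
  (renameEquiv R (finRotate (n + 1))).trans (finSuccEquiv R n)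

theorem lastVariable_X_castSucc (R : Type*) [CommSemiring R] {n : ℕ} (i : Fin n) :
    lastVariable R n (X i.castSucc) = Polynomial.C (X i) := by
  simp [lastVariable, finSuccEquiv_X_succ]

theorem lastVariable_X_last (R : Type*) [CommSemiring R] (n : ℕ) :
    lastVariable R n (X (Fin.last n)) = Polynomial.X := by
  simp [lastVariable, finSuccEquiv_X_zero]

theorem squarefree_of_squarefree_specialization {n : ℕ} {f : MvPolynomial (Fin (n + 1)) K}
    (hf : IsUnit (lastVariable K n f).leadingCoeff) (s : Fin n → K)
    (hsq : Squarefree ((lastVariable K n f).map (eval s))) : Squarefree f :=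
  have hlast := squarefree_of_squarefree_map (eval s) hf hsq
  fun p hp => (MulEquiv.isUnit_map (lastVariable K n)).mp <|
    hlast _ (by simpa only [map_mul] using map_dvd (lastVariable K n) hp)

end Squarefree

section PolynomialIdentities

variable {R S F : Type*} [CommRing R] [CommRing S] [FunLike F R S] [RingHomClass F R S] (φ : F)

theorem map_exprDH4Zero (t1 t6 t10 t15 : R) :
    φ (exprDH4Zero t1 t6 t10 t15) = exprDH4Zero (φ t1) (φ t6) (φ t10) (φ t15) := by
  simp only [exprDH4Zero, map_add, map_sub, map_mul, map_pow, map_neg, map_ofNat]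

theorem map_exprDH4One (t1 t3 t5 t10 : R) :
    φ (exprDH4One t1 t3 t5 t10) = exprDH4One (φ t1) (φ t3) (φ t5) (φ t10) := by
  simp only [exprDH4One, map_add, map_sub, map_mul, map_pow, map_neg, map_ofNat]

theorem leadingCoeff_exprDH4Zero [CharZero R] (a b c : R) :
    (exprDH4Zero (.C a) (.C b) (.C c) .X : Polynomial R).leadingCoeff = 729 := by
  have hdeg : (exprDH4Zero (.C a) (.C b) (.C c) .X : Polynomial R).natDegree = 4 := by
    simp only [exprDH4Zero]
    compute_degree!
  rw [Polynomial.leadingCoeff, hdeg]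
  simp only [exprDH4Zero]
  compute_degree!

theorem leadingCoeff_exprDH4One [CharZero R] (a b c : R) :
    (exprDH4One (.C a) (.C b) (.C c) .X : Polynomial R).leadingCoeff = 16 := by
  have hdeg : (exprDH4One (.C a) (.C b) (.C c) .X : Polynomial R).natDegree = 4 := by
    simp only [exprDH4One]
    compute_degree!
  rw [Polynomial.leadingCoeff, hdeg]
  simp only [exprDH4One]
  compute_degree!

-- The parameters are chosen so that the quartic in the last variable splits over `ℚ`.
theorem exprDH4Zero_eq_C_mul_prod : exprDH4Zero 0 (-1) (-12) (.X : Polynomial ℂ) =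
    .C 729 * ∏ i, (.X - .C ((![14, -14, 18, -18] : Fin 4 → ℂ) i)) := by
  simp only [exprDH4Zero, Fin.prod_univ_four, Matrix.cons_val, map_neg, map_ofNat]
  ring

theorem X_mul_exprDH4One_eq_C_mul_prod : .X * exprDH4One 0 12 (-336) (.X : Polynomial ℂ) =
    .C 16 * ∏ i, (.X - .C ((![0, 28224, 34560, 32832, -39168] : Fin 5 → ℂ) i)) := by
  simp only [exprDH4One, Fin.prod_univ_five, Matrix.cons_val, map_zero, map_neg, map_ofNat]
  ring

theorem lastVariable_polyDH4Zero : lastVariable ℂ 3 polyDH4Zero =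
    exprDH4Zero (.C (X 0)) (.C (X 1)) (.C (X 2)) .X := by
  rw [← lastVariable_X_last, ← lastVariable_X_castSucc, ← lastVariable_X_castSucc,
    ← lastVariable_X_castSucc]
  exact map_exprDH4Zero (lastVariable ℂ 3) _ _ _ _

theorem lastVariable_polyDH4One : lastVariable ℂ 3 polyDH4One =
    exprDH4One (.C (X 0)) (.C (X 1)) (.C (X 2)) .X := by
  rw [← lastVariable_X_last, ← lastVariable_X_castSucc, ← lastVariable_X_castSucc,
    ← lastVariable_X_castSucc]
  exact map_exprDH4One (lastVariable ℂ 3) _ _ _ _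

theorem squarefree_polyDH4Zero : Squarefree polyDH4Zero := by
  refine squarefree_of_squarefree_specialization ?_ ![0, -1, -12] ?_
  · rw [lastVariable_polyDH4Zero, leadingCoeff_exprDH4Zero]
    exact IsUnit.map C (x := (729 : ℂ)) (by norm_num)
  · rw [lastVariable_polyDH4Zero, ← Polynomial.coe_mapRingHom, map_exprDH4Zero]
    simp only [Polynomial.coe_mapRingHom, Polynomial.map_C, Polynomial.map_X, eval_X,
      Matrix.cons_val, map_zero, map_neg, map_one, map_ofNat]
    rw [exprDH4Zero_eq_C_mul_prod]
    refine squarefree_C_mul_prod_X_sub_C (by norm_num) fun i j h => ?_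
    fin_cases i <;> fin_cases j <;> first | rfl | norm_num at h

theorem squarefree_X_mul_polyDH4One : Squarefree (X 3 * polyDH4One) := by
  have hlast : lastVariable ℂ 3 (X 3 * polyDH4One) =
      .X * exprDH4One (.C (X 0)) (.C (X 1)) (.C (X 2)) .X := by
    rw [map_mul, lastVariable_polyDH4One]
    exact congrArg (· * _) (lastVariable_X_last ℂ 3)
  refine squarefree_of_squarefree_specialization ?_ ![0, 12, -336] ?_
  · rw [hlast, Polynomial.leadingCoeff_mul, Polynomial.leadingCoeff_X, one_mul,
      leadingCoeff_exprDH4One]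
    exact IsUnit.map C (x := (16 : ℂ)) (by norm_num)
  · rw [hlast, Polynomial.map_mul, ← Polynomial.coe_mapRingHom, map_exprDH4One]
    simp only [Polynomial.coe_mapRingHom, Polynomial.map_C, Polynomial.map_X, eval_X,
      Matrix.cons_val, map_zero, map_neg, map_ofNat]
    rw [X_mul_exprDH4One_eq_C_mul_prod]
    refine squarefree_C_mul_prod_X_sub_C (by norm_num) fun i j h => ?_
    fin_cases i <;> fin_cases j <;> first | rfl | norm_num at h

end PolynomialIdentities

section SingularSurfaces

theorem pderiv_castSucc_surface (f : MvPolynomial (Fin 2) ℂ) (i : Fin 2) :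
    pderiv i.castSucc (surface f) = -rename Fin.castSucc (pderiv i f) := by
  have hX : pderiv i.castSucc (X 2 ^ 2 : MvPolynomial (Fin 3) ℂ) = 0 := by
    rw [pderiv_pow, pderiv_X_of_ne (show 2 ≠ i.castSucc from i.castSucc_lt_last.ne'), mul_zero]
  rw [surface, map_sub, hX, pderiv_rename (Fin.castSucc_injective 2), zero_sub]

theorem pderiv_last_surface (f : MvPolynomial (Fin 2) ℂ) : pderiv 2 (surface f) = 2 * X 2 := by
  have hf : pderiv (2 : Fin 3) (rename Fin.castSucc f) = 0 := by
    refine pderiv_eq_zero_of_notMem_vars fun h => ?_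
    obtain ⟨i, -, hi⟩ := Finset.mem_image.mp (vars_rename Fin.castSucc f h)
    exact i.castSucc_lt_last.ne hi
  rw [surface, map_sub, hf, sub_zero, pderiv_pow, pderiv_X_self, mul_one, pow_one, Nat.cast_ofNat]

theorem isSingularSurface_surface_iff (f : MvPolynomial (Fin 2) ℂ) :
    IsSingularSurface (surface f) ↔
      ∃ p : Fin 2 → ℂ, eval p f = 0 ∧ ∀ i, eval p (pderiv i f) = 0 := by
  simp only [IsSingularSurface, Fin.forall_fin_succ' (n := 2), pderiv_castSucc_surface, map_neg,
    neg_eq_zero, eval_rename, Fin.reduceLast, pderiv_last_surface]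
  constructor
  · rintro ⟨p, hp, hpderiv, hlast⟩
    have hp2 : p 2 = 0 := by simpa using hlast
    exact ⟨p ∘ Fin.castSucc, by simpa [surface, eval_rename, hp2] using hp, hpderiv⟩
  · rintro ⟨p, hp, hpderiv⟩
    have hcomp : ![p 0, p 1, 0] ∘ Fin.castSucc = p := by
      funext i; fin_cases i <;> rfl
    refine ⟨![p 0, p 1, 0], ?_, ?_, ?_⟩
    · simp [surface, eval_rename, hcomp, hp]
    · simpa only [hcomp] using hpderiv
    · simp

theorem eval_bind₁ {σ τ R : Type*} [CommSemiring R] (g : σ → MvPolynomial τ R)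
    (f : MvPolynomial σ R) (p : τ → R) :
    eval p (bind₁ g f) = eval (fun i => eval p (g i)) f :=
  eval₂Hom_bind₁ _ _ _ _

theorem pderiv_bind₁_X_add_C {σ R : Type*} [CommSemiring R] (c : σ → R) (i : σ)
    (f : MvPolynomial σ R) :
    pderiv i (bind₁ (fun j => X j + C (c j)) f) = bind₁ (fun j => X j + C (c j)) (pderiv i f) := by
  classical
  induction f using MvPolynomial.induction_on with
  | C a => simp only [bind₁_C_right, pderiv_C, map_zero]
  | add p q hp hq => simp only [map_add, hp, hq]
  | mul_X p j hp =>
    rw [map_mul, bind₁_X_right, Derivation.leibniz, Derivation.leibniz, hp, map_add, pderiv_C,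
      pderiv_X, Pi.single_apply]
    split_ifs <;> simp

theorem isSingularSurface_surface_bind₁_X_add_C (c : Fin 2 → ℂ) (f : MvPolynomial (Fin 2) ℂ) :
    IsSingularSurface (surface (bind₁ (fun j => X j + C (c j)) f)) ↔
      IsSingularSurface (surface f) := by
  simp only [isSingularSurface_surface_iff, pderiv_bind₁_X_add_C, eval_bind₁, map_add, eval_X,
    eval_C]
  exact (Equiv.addRight c).exists_congr_left.trans (by simp [Equiv.addRight])

end SingularSurfaces

section DiscriminantLocusH4Zero

theorem derivation_ofNat {R A M : Type*} [CommSemiring R] [CommSemiring A] [AddCommMonoid M]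
    [Algebra R A] [Module R M] [Module A M] (D : Derivation R A M) (n : ℕ) [n.AtLeastTwo] :
    D (ofNat(n) : A) = 0 :=
  D.map_natCast n

theorem eval_fH4Zero (t : Fin 4 → ℂ) (p : Fin 2 → ℂ) :
    eval p (fH4Zero t) = exprFH4Zero (t 0) (t 1) (t 2) (t 3) (p 0) (p 1) := by
  simp [fH4Zero, exprFH4Zero]

theorem eval_pderiv_zero_fH4Zero (t : Fin 4 → ℂ) (p : Fin 2 → ℂ) :
    eval p (pderiv 0 (fH4Zero t)) =
      5 * ((t 0 * p 1 + t 1) ^ 2 + 3 * p 0 ^ 2 * (t 0 * p 1 + t 1) + p 0 ^ 4) := by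
  simp only [fH4Zero, exprFH4Zero, map_add, map_mul, map_pow, Derivation.leibniz,
    Derivation.leibniz_pow, pderiv_C, derivation_ofNat, pderiv_X, Pi.single_apply, Fin.reduceEq,
    if_true, if_false, smul_eq_mul, nsmul_eq_mul, Nat.cast_ofNat, Nat.reduceSub, map_zero, map_one,
    map_ofNat, eval_C, eval_X]
  ring

theorem eval_pderiv_one_fH4Zero (t : Fin 4 → ℂ) (p : Fin 2 → ℂ) :
    eval p (pderiv 1 (fH4Zero t)) =
      5 * t 0 * (p 0 ^ 3 + 2 * (t 0 * p 1 + t 1) * p 0) + t 2 + 3 * p 1 ^ 2 := by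
  simp only [fH4Zero, exprFH4Zero, map_add, map_mul, map_pow, Derivation.leibniz,
    Derivation.leibniz_pow, pderiv_C, derivation_ofNat, pderiv_X, Pi.single_apply, Fin.reduceEq,
    if_true, if_false, smul_eq_mul, nsmul_eq_mul, Nat.cast_ofNat, Nat.reduceSub, map_zero, map_one,
    map_ofNat, eval_C, eval_X]
  ring

-- The quintic is the Dickson polynomial `D₅(x, s²)`, and `h` makes `x` a critical point of it,
-- since its derivative is `5 (x² - s x - s²) (x² + s x - s²)`.
theorem dickson_of_sq_eq {R : Type*} [CommRing R] {x s : R} (h : x ^ 2 = s * x + s ^ 2) :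
    x ^ 3 - 2 * s ^ 2 * x = s ^ 3 ∧ x ^ 5 - 5 * s ^ 2 * x ^ 3 + 5 * s ^ 4 * x = -2 * s ^ 5 :=
  ⟨by linear_combination (x + s) * h,
    by linear_combination (x ^ 3 + s * x ^ 2 - 3 * s ^ 2 * x - 2 * s ^ 3) * h⟩

theorem mem_discriminantLocus_fH4Zero_iff_exists (t : Fin 4 → ℂ) :
    t ∈ discriminantLocus fH4Zero ↔ ∃ s y : ℂ, s ^ 2 + t 0 * y + t 1 = 0 ∧
      3 * y ^ 2 + t 2 + 5 * t 0 * s ^ 3 = 0 ∧ y ^ 3 + t 2 * y + t 3 = 2 * s ^ 5 := by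
  simp only [discriminantLocus, Set.mem_ofPred_eq, isSingularSurface_surface_iff,
    Fin.forall_fin_two, eval_fH4Zero, eval_pderiv_zero_fH4Zero, eval_pderiv_one_fH4Zero,
    exprFH4Zero]
  constructor
  · rintro ⟨p, hf, hx, hy⟩
    obtain ⟨s, hs, hps⟩ : ∃ s : ℂ, s ^ 2 + t 0 * p 1 + t 1 = 0 ∧ p 0 ^ 2 = s * p 0 + s ^ 2 := by
      obtain ⟨s, hs⟩ := IsAlgClosed.exists_pow_nat_eq (-(t 0 * p 1 + t 1)) two_pos
      have hfactor : (p 0 ^ 2 - s * p 0 - s ^ 2) * (p 0 ^ 2 + s * p 0 - s ^ 2) = 0 := by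
        linear_combination hx / 5 + (s ^ 2 - 3 * p 0 ^ 2 - t 0 * p 1 - t 1) * hs
      rcases mul_eq_zero.mp hfactor with h | h
      · exact ⟨s, by linear_combination hs, by linear_combination h⟩
      · exact ⟨-s, by linear_combination hs, by linear_combination h⟩
    obtain ⟨hcube, hquint⟩ := dickson_of_sq_eq hps
    refine ⟨s, p 1, hs, ?_, ?_⟩
    · linear_combination hy - 5 * t 0 * hcube - 10 * t 0 * p 0 * hs
    · linear_combination hf - hquint -
        (5 * p 0 ^ 3 + 5 * p 0 * (t 0 * p 1 + t 1 - s ^ 2)) * hs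
  · rintro ⟨s, y, hs, hy, hf⟩
    obtain ⟨x, hx⟩ : ∃ x : ℂ, x ^ 2 = s * x + s ^ 2 := by
      have hgolden : (Real.goldenRatio : ℂ) ^ 2 = Real.goldenRatio + 1 := by
        exact_mod_cast Real.goldenRatio_sq
      exact ⟨Real.goldenRatio * s, by linear_combination s ^ 2 * hgolden⟩
    obtain ⟨hcube, hquint⟩ := dickson_of_sq_eq hx
    refine ⟨![x, y], ?_, ?_, ?_⟩ <;> simp only [Matrix.cons_val_zero, Matrix.cons_val_one]
    · linear_combination hf + hquint + (5 * x ^ 3 + 5 * x * (t 0 * y + t 1 - s ^ 2)) * hs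
    · linear_combination 5 * (x ^ 2 + s * x - s ^ 2) * hx +
        5 * (t 0 * y + t 1 - s ^ 2 + 3 * x ^ 2) * hs
    · linear_combination hy + 5 * t 0 * hcube + 10 * t 0 * x * hs

/-- Multiplication by `y` on the subalgebra `ℂ[y, σ] / (3y² + t₁₀ + 5t₁σ, σ² + w³)` of the Jacobian
algebra `ℂ[x, y] / (f_x, f_y)`, where `w = t₁y + t₆` and `σ = x³ + 2wx`. The rows contain the images
of the elements of the basis `1, y, σ, σy`. -/
def mulY (t : Fin 4 → ℂ) : Matrix (Fin 4) (Fin 4) ℂ :=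
  !![0, 1, 0, 0;
    -t 2 / 3, 0, -5 / 3 * t 0, 0;
    0, 0, 0, 1;
    5 / 3 * t 0 * (t 1 ^ 3 - t 0 ^ 2 * t 1 * t 2), 5 / 9 * t 0 ^ 2 * (9 * t 1 ^ 2 - t 0 ^ 2 * t 2),
      -t 2 / 3 - 25 / 3 * t 0 ^ 4 * t 1, -25 / 9 * t 0 ^ 5]

/-- Multiplication by `σ` on the algebra of `mulY`. -/
def mulS (t : Fin 4 → ℂ) : Matrix (Fin 4) (Fin 4) ℂ :=
  !![0, 0, 1, 0;
    0, 0, 0, 1;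
    t 0 ^ 2 * t 1 * t 2 - t 1 ^ 3, t 0 * (t 0 ^ 2 * t 2 / 3 - 3 * t 1 ^ 2), 5 * t 0 ^ 3 * t 1,
      5 / 3 * t 0 ^ 4;
    25 / 9 * t 0 ^ 5 * (t 1 ^ 3 - t 0 ^ 2 * t 1 * t 2) + t 0 * t 2 * (t 1 ^ 2 - t 0 ^ 2 * t 2 / 9),
      t 0 ^ 2 * t 1 * t 2 - t 1 ^ 3 + 25 / 27 * t 0 ^ 6 * (9 * t 1 ^ 2 - t 0 ^ 2 * t 2),
      5 / 9 * t 0 ^ 2 * (9 * t 1 ^ 2 - 2 * t 0 ^ 2 * t 2) - 125 / 9 * t 0 ^ 8 * t 1,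
      5 * t 0 ^ 3 * t 1 - 125 / 27 * t 0 ^ 9]

/-- Multiplication by `f` on the algebra of `mulY`, in which
`f = t₁₅ + 2/3 t₁₀ y + 2 t₆ σ + 1/3 t₁ σy`. -/
def mulN (t : Fin 4 → ℂ) : Matrix (Fin 4) (Fin 4) ℂ :=
  t 3 • 1 + (2 / 3 * t 2) • mulY t + (2 * t 1) • mulS t + (t 0 / 3) • (mulS t * mulY t)

theorem commute_mulY_mulS (t : Fin 4 → ℂ) : Commute (mulY t) (mulS t) := by
  ext i j
  revert i j
  simp only [mulY, mulS, Matrix.mul_apply, Fin.sum_univ_four, Matrix.of_apply, Fin.forall_fin_succ,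
    Fin.reduceSucc, IsEmpty.forall_iff, and_true, Fin.succ_zero_eq_one, Matrix.cons_val]
  refine ⟨⟨?_, ?_, ?_, ?_⟩, ⟨?_, ?_, ?_, ?_⟩, ⟨?_, ?_, ?_, ?_⟩, ⟨?_, ?_, ?_, ?_⟩⟩ <;> ring

theorem exists_common_eigenvector_iff (t : Fin 4 → ℂ) (y σ : ℂ) :
    (∃ v ≠ 0, (mulY t).mulVec v = y • v ∧ (mulS t).mulVec v = σ • v) ↔
      3 * y ^ 2 + t 2 + 5 * t 0 * σ = 0 ∧ σ ^ 2 + (t 0 * y + t 1) ^ 3 = 0 := by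
  simp only [mulY, mulS, funext_iff, Fin.forall_fin_succ, Fin.reduceSucc, IsEmpty.forall_iff,
    and_true, Fin.succ_zero_eq_one, Matrix.mulVec, dotProduct,
    Fin.sum_univ_four, Matrix.of_apply, Matrix.cons_val, Pi.smul_apply, smul_eq_mul]
  constructor
  · rintro ⟨v, hv, ⟨hY0, hY1, -, -⟩, hS0, hS1, hS2, -⟩
    have hv1 : v 1 = y * v 0 := by linear_combination hY0
    have hv2 : v 2 = σ * v 0 := by linear_combination hS0
    have hv3 : v 3 = σ * (y * v 0) := by linear_combination hS1 + σ * hv1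
    have hv0 : v 0 ≠ 0 := fun h0 => hv (funext fun i => by fin_cases i <;> simp [*])
    rw [hv1, hv2] at hY1
    rw [hv1, hv2, hv3] at hS2
    have hy : 3 * y ^ 2 + t 2 + 5 * t 0 * σ = 0 :=
      mul_right_cancel₀ hv0 (by linear_combination -3 * hY1)
    exact ⟨hy, mul_right_cancel₀ hv0
      (by linear_combination (t 0 ^ 3 * y / 3 + t 0 ^ 2 * t 1) * v 0 * hy - hS2)⟩
  · rintro ⟨hy, hσ⟩
    have hσ' : σ ^ 2 = t 0 ^ 2 * t 1 * t 2 - t 1 ^ 3 +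
        t 0 * (t 0 ^ 2 * t 2 / 3 - 3 * t 1 ^ 2) * y + 5 * t 0 ^ 3 * t 1 * σ +
          5 / 3 * t 0 ^ 4 * (σ * y) := by
      linear_combination hσ - (t 0 ^ 3 * y / 3 + t 0 ^ 2 * t 1) * hy
    refine ⟨![1, y, σ, σ * y], fun h => one_ne_zero (congrFun h 0), ?_⟩
    simp only [Matrix.cons_val]
    refine ⟨⟨by ring, ?_, by ring, ?_⟩, by ring, by ring, ?_, ?_⟩
    · linear_combination -1 / 3 * hy
    · linear_combination 5 / 3 * t 0 * hσ' - σ / 3 * hy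
    · linear_combination -hσ'
    · linear_combination (25 / 9 * t 0 ^ 5 - y) * hσ' -
        (5 / 9 * t 0 ^ 4 * σ + t 0 / 3 * (t 0 ^ 2 * t 2 / 3 - 3 * t 1 ^ 2)) * hy

theorem det_mulN_eq_zero_iff (t : Fin 4 → ℂ) : (mulN t).det = 0 ↔ ∃ y σ : ℂ,
    3 * y ^ 2 + t 2 + 5 * t 0 * σ = 0 ∧ σ ^ 2 + (t 0 * y + t 1) ^ 3 = 0 ∧
      t 3 + 2 / 3 * t 2 * y + 2 * t 1 * σ + t 0 / 3 * (σ * y) = 0 := by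
  have mulVec_mulN {y σ : ℂ} {v : Fin 4 → ℂ} (hY : (mulY t).mulVec v = y • v)
      (hS : (mulS t).mulVec v = σ • v) : (mulN t).mulVec v =
        (t 3 + 2 / 3 * t 2 * y + 2 * t 1 * σ + t 0 / 3 * (σ * y)) • v := by
    simp only [mulN, Matrix.add_mulVec, Matrix.smul_mulVec, Matrix.one_mulVec,
      ← Matrix.mulVec_mulVec, hY, hS, Matrix.mulVec_smul]
    module
  constructor
  · intro hdet
    have hYS := commute_mulY_mulS t
    have hYN : Commute (mulY t) (mulN t) :=
      ((((Commute.one_right _).smul_right _).add_right ((Commute.refl _).smul_right _)).add_right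
        (hYS.smul_right _)).add_right ((hYS.mul_right (Commute.refl _)).smul_right _)
    have hSN : Commute (mulS t) (mulN t) :=
      ((((Commute.one_right _).smul_right _).add_right (hYS.symm.smul_right _)).add_right
        ((Commute.refl _).smul_right _)).add_right
          (((Commute.refl _).mul_right hYS.symm).smul_right _)
    obtain ⟨y, σ, v, hv, hY, hS, hN⟩ :=
      exists_common_eigenvector_of_det_eq_zero hYS hYN hSN hdet
    obtain ⟨hy, hσ⟩ := (exists_common_eigenvector_iff t y σ).mp ⟨v, hv, hY, hS⟩
    exact ⟨y, σ, hy, hσ, (smul_eq_zero.mp ((mulVec_mulN hY hS).symm.trans hN)).resolve_right hv⟩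
  · rintro ⟨y, σ, hy, hσ, hN⟩
    obtain ⟨v, hv, hY, hS⟩ := (exists_common_eigenvector_iff t y σ).mpr ⟨hy, hσ⟩
    exact Matrix.exists_mulVec_eq_zero_iff.mp ⟨v, hv, by rw [mulVec_mulN hY hS, hN, zero_smul]⟩

theorem exists_sq_eq_and_cube_eq {K : Type*} [Field K] [IsAlgClosed K] {u σ : K}
    (h : σ ^ 2 = u ^ 3) : ∃ s, s ^ 2 = u ∧ s ^ 3 = σ := by
  obtain ⟨s, hs⟩ := IsAlgClosed.exists_pow_nat_eq u two_pos
  have hfactor : (s ^ 3 - σ) * ((-s) ^ 3 - σ) = 0 := by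
    linear_combination h - (u ^ 2 + u * s ^ 2 + s ^ 4) * hs
  rcases mul_eq_zero.mp hfactor with h | h
  · exact ⟨s, hs, sub_eq_zero.mp h⟩
  · exact ⟨-s, by rw [neg_sq, hs], sub_eq_zero.mp h⟩

theorem mem_discriminantLocus_fH4Zero_iff_det (t : Fin 4 → ℂ) :
    t ∈ discriminantLocus fH4Zero ↔ (mulN t).det = 0 := by
  rw [mem_discriminantLocus_fH4Zero_iff_exists, det_mulN_eq_zero_iff]
  constructor
  · rintro ⟨s, y, hs, hy, hf⟩
    refine ⟨y, s ^ 3, hy, ?_, ?_⟩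
    · linear_combination (s ^ 4 - s ^ 2 * (t 0 * y + t 1) + (t 0 * y + t 1) ^ 2) * hs
    · linear_combination hf + 2 * s ^ 3 * hs - y / 3 * hy
  · rintro ⟨y, σ, hy, hσ, hN⟩
    obtain ⟨s, hs, rfl⟩ := exists_sq_eq_and_cube_eq
      (show σ ^ 2 = (-(t 0 * y + t 1)) ^ 3 by linear_combination hσ)
    refine ⟨s, y, by linear_combination hs, hy, ?_⟩
    linear_combination hN - 2 * s ^ 3 * hs + y / 3 * hy

theorem det_fin_four {R : Type*} [CommRing R] (M : Matrix (Fin 4) (Fin 4) R) :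
    M.det =
      (M 0 0 * M 1 1 - M 0 1 * M 1 0) * (M 2 2 * M 3 3 - M 2 3 * M 3 2) -
      (M 0 0 * M 1 2 - M 0 2 * M 1 0) * (M 2 1 * M 3 3 - M 2 3 * M 3 1) +
      (M 0 0 * M 1 3 - M 0 3 * M 1 0) * (M 2 1 * M 3 2 - M 2 2 * M 3 1) +
      (M 0 1 * M 1 2 - M 0 2 * M 1 1) * (M 2 0 * M 3 3 - M 2 3 * M 3 0) -
      (M 0 1 * M 1 3 - M 0 3 * M 1 1) * (M 2 0 * M 3 2 - M 2 2 * M 3 0) +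
      (M 0 2 * M 1 3 - M 0 3 * M 1 2) * (M 2 0 * M 3 1 - M 2 1 * M 3 0) := by
  simp only [Matrix.det_succ_row_zero, Matrix.det_unique, Fin.default_eq_zero, Fin.sum_univ_succ,
    Fin.succAbove, Matrix.submatrix_apply, Finset.univ_unique, Finset.sum_singleton, Fin.reduceSucc,
    Fin.reduceCastSucc, Fin.reduceLT, if_true, if_false, Fin.coe_ofNat_eq_mod]
  ring

theorem det_mulN (t : Fin 4 → ℂ) :
    729 * (mulN t).det = exprDH4Zero (t 0) (t 1) (t 2) (t 3) := by
  simp only [det_fin_four, mulN, mulY, mulS, exprDH4Zero, Matrix.add_apply, Matrix.smul_apply,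
    Matrix.mul_apply, Fin.sum_univ_four, Matrix.one_apply, Fin.reduceEq, if_true, if_false,
    Matrix.of_apply, Matrix.cons_val, smul_eq_mul]
  ring

theorem eval_polyDH4Zero (t : Fin 4 → ℂ) :
    eval t polyDH4Zero = exprDH4Zero (t 0) (t 1) (t 2) (t 3) := by
  simp only [polyDH4Zero, map_exprDH4Zero, eval_X]

theorem discriminantLocus_fH4Zero : discriminantLocus fH4Zero = {t | eval t polyDH4Zero = 0} := by
  ext t
  rw [mem_discriminantLocus_fH4Zero_iff_det, Set.mem_ofPred_eq, eval_polyDH4Zero, ← det_mulN,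
    mul_eq_zero_iff_left (by norm_num)]

end DiscriminantLocusH4Zero

section Discriminants

theorem isDiscriminant_fH4Zero : IsDiscriminant fH4Zero polyDH4Zero :=
  ⟨squarefree_polyDH4Zero, discriminantLocus_fH4Zero⟩

theorem eval_fH4One (t : Fin 4 → ℂ) (p : Fin 2 → ℂ) :
    eval p (fH4One t) = exprFH4One (t 0) (t 1) (t 2) (t 3) (p 0) (p 1) := by
  simp [fH4One, exprFH4One]

theorem eval_polyDH4One (t : Fin 4 → ℂ) :
    eval t polyDH4One = exprDH4One (t 0) (t 1) (t 2) (t 3) := by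
  simp only [polyDH4One, map_exprDH4One, eval_X]

theorem bind₁_fH4One (t : Fin 4 → ℂ) :
    bind₁ ![X 0 - C (2 * t 1), X 1 + C (1 / 3 * (10 * t 0 ^ 2 * t 1 - t 2))] (fH4One t) =
      fH4Zero (substU t) := by
  refine MvPolynomial.funext fun p => ?_
  rw [eval_bind₁, eval_fH4One, eval_fH4Zero]
  simp only [exprFH4One, exprFH4Zero, substU, Matrix.cons_val, map_sub, map_add, eval_X, eval_C]
  ring

theorem eval_substU_polyDH4Zero (t : Fin 4 → ℂ) :
    eval (substU t) polyDH4Zero = t 3 ^ 2 * eval t polyDH4One := by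
  rw [eval_polyDH4Zero, eval_polyDH4One]
  simp only [exprDH4One, exprDH4Zero, substU, Matrix.cons_val]
  ring

theorem mem_discriminantLocus_fH4One_iff_substU (t : Fin 4 → ℂ) :
    t ∈ discriminantLocus fH4One ↔ substU t ∈ discriminantLocus fH4Zero := by
  have htranslation : ![X 0 - C (2 * t 1), X 1 + C (1 / 3 * (10 * t 0 ^ 2 * t 1 - t 2))] =
      fun j => X j + C (![-(2 * t 1), 1 / 3 * (10 * t 0 ^ 2 * t 1 - t 2)] j) := by
    funext j
    fin_cases j
    · exact (sub_eq_add_neg _ _).trans (congrArg _ (map_neg C _).symm)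
    · rfl
  rw [discriminantLocus, discriminantLocus, Set.mem_ofPred_eq, Set.mem_ofPred_eq, ← bind₁_fH4One,
    htranslation, isSingularSurface_surface_bind₁_X_add_C]

theorem isDiscriminant_fH4One : IsDiscriminant fH4One (X 3 * polyDH4One) := by
  refine ⟨squarefree_X_mul_polyDH4One, Set.ext fun t => ?_⟩
  rw [mem_discriminantLocus_fH4One_iff_substU, discriminantLocus_fH4Zero, Set.mem_ofPred_eq,
    Set.mem_ofPred_eq, eval_substU_polyDH4Zero, map_mul, eval_X, mul_eq_zero, mul_eq_zero,
    pow_eq_zero_iff two_ne_zero]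

end Discriminants

section CoordinateChanges

theorem bijective_coordH4Zero : Function.Bijective coordH4Zero := by
  refine Function.bijective_iff_has_inverse.mpr ⟨fun x =>
    let t₆ := (10 * x 0 ^ 6 - 225 / 4 * x 1) / 27
    let t₁₀ := (500 * x 0 ^ 10 - 2025 * x 0 ^ 4 * t₆ - 50625 / 2 * x 2) / 486
    ![x 0, t₆, t₁₀, (11390625 / 8 * x 3 - 8125 * x 0 ^ 15 + 47250 * x 0 ^ 9 * t₆ +
      7290 * x 0 ^ 5 * t₁₀ - 54675 * x 0 ^ 3 * t₆ ^ 2) / 13122], fun t => ?_, fun x => ?_⟩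
  all_goals
    simp only [funext_iff, Fin.forall_fin_succ, Fin.reduceSucc, Fin.succ_zero_eq_one,
      IsEmpty.forall_iff, and_true, coordH4Zero, Matrix.cons_val]
    refine ⟨trivial, ?_, ?_, ?_⟩ <;> ring

theorem bijective_coordH4One : Function.Bijective coordH4One := by
  refine Function.bijective_iff_has_inverse.mpr ⟨fun x =>
    let t₃ := x 2 / 16
    let t₅ := (5 * x 1 - 17 * x 0 ^ 5 + 160 * x 0 ^ 2 * t₃) / 16
    ![x 0, t₃, t₅, (987 * x 0 ^ 10 - 15120 * x 0 ^ 7 * t₃ + 1512 * x 0 ^ 5 * t₅ +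
      50400 * x 0 ^ 4 * t₃ ^ 2 - 8960 * x 0 ^ 2 * t₃ * t₅ - 12800 * x 0 * t₃ ^ 3 +
      448 * t₅ ^ 2 - 25 / 8 * x 3) / 2560], fun t => ?_, fun x => ?_⟩
  all_goals
    simp only [funext_iff, Fin.forall_fin_succ, Fin.reduceSucc, Fin.succ_zero_eq_one,
      IsEmpty.forall_iff, and_true, coordH4One, Matrix.cons_val]
    refine ⟨trivial, ?_, ?_, ?_⟩ <;> ring

end CoordinateChanges

section EulerOperator

variable {σ R : Type*} [CommRing R] (w : σ → R)

/-- The Euler vector field `∑ₖ wₖ Xₖ ∂ₖ` as a derivation of polynomials. A polynomial is weighted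
homogeneous of degree `d` when it is an eigenvector with eigenvalue `d`. -/
def eulerDerivation : Derivation R (MvPolynomial σ R) (MvPolynomial σ R) :=
  mkDerivation R fun k => w k • X k

theorem eulerDerivation_X (k : σ) : eulerDerivation w (X k) = w k • X k :=
  mkDerivation_X R _ k

theorem eulerDerivation_eq_sum [Fintype σ] (p : MvPolynomial σ R) :
    eulerDerivation w p = ∑ k, w k • (X k * pderiv k p) := by
  classical
  have hsum : eulerDerivation w = ∑ k, (w k • X k : MvPolynomial σ R) • pderiv k := by
    refine MvPolynomial.derivation_ext fun i => ?_
    rw [eulerDerivation_X, ← Derivation.coeFnAddMonoidHom_apply, map_sum, Finset.sum_apply]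
    simp [pderiv_X, Pi.single_apply]
  rw [hsum, ← Derivation.coeFnAddMonoidHom_apply, map_sum, Finset.sum_apply]
  simp

variable {w}

theorem eulerDerivation_pderiv {p : MvPolynomial σ R} {d : R}
    (hp : eulerDerivation w p = d • p) (i : σ) :
    eulerDerivation w (pderiv i p) = (d - w i) • pderiv i p := by
  classical
  have hbracket : ⁅eulerDerivation w, (pderiv i : Derivation R (MvPolynomial σ R) _)⁆ =
      -(w i • pderiv i) := by
    refine MvPolynomial.derivation_ext fun k => ?_
    by_cases hk : k = i <;>
      simp [Derivation.commutator_apply, eulerDerivation_X, pderiv_X, hk]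
  have happly := congrArg (fun D => D p) hbracket
  simp only [Derivation.commutator_apply, hp, Derivation.map_smul, Derivation.neg_apply,
    Derivation.smul_apply] at happly
  rw [sub_smul, sub_eq_add_neg, ← happly, add_sub_cancel]

theorem eulerDerivation_mul {p q : MvPolynomial σ R} {d e : R} (hp : eulerDerivation w p = d • p)
    (hq : eulerDerivation w q = e • q) : eulerDerivation w (p * q) = (d + e) • (p * q) := by
  rw [Derivation.leibniz, hp, hq, smul_eq_mul, smul_eq_mul, mul_smul_comm, mul_smul_comm,
    mul_comm q p, ← add_smul, add_comm e d]

end EulerOperator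

section PolynomialFunctions

theorem hasFDerivAt_eval {n : ℕ} (p : MvPolynomial (Fin n) ℂ) (x : Fin n → ℂ) :
    HasFDerivAt (fun x : Fin n → ℂ => eval x p)
      (∑ k, eval x (pderiv k p) • (ContinuousLinearMap.proj k : (Fin n → ℂ) →L[ℂ] ℂ)) x := by
  induction p using MvPolynomial.induction_on with
  | C a =>
    simp only [eval_C]
    refine (hasFDerivAt_const a x).congr_fderiv ?_
    ext v
    simp
  | add p q hp hq =>
    simp only [map_add (eval _)]
    refine (hp.fun_add hq).congr_fderiv ?_
    ext v
    simp [add_mul, Finset.sum_add_distrib]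
  | mul_X p i hp =>
    simp only [map_mul, eval_X]
    refine (hp.fun_mul (hasFDerivAt_apply i x)).congr_fderiv ?_
    ext v
    simp [Derivation.leibniz, pderiv_X, Pi.single_apply, add_mul, Finset.sum_add_distrib,
      Finset.mul_sum, apply_ite, ite_mul, mul_assoc]

theorem pd_eval (j : Fin 4) (p : MvPolynomial (Fin 4) ℂ) :
    pd j (fun x => eval x p) = fun x => eval x (pderiv j p) := by
  funext x
  rw [pd, (hasFDerivAt_eval p x).fderiv]
  simp [Pi.single_apply]

theorem euler_eval (w : Fin 4 → ℂ) (p : MvPolynomial (Fin 4) ℂ) (x : Fin 4 → ℂ) :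
    euler w (fun x => eval x p) x = 1 / w 3 * eval x (eulerDerivation w p) := by
  simp only [euler, pd_eval, eulerDerivation_eq_sum, map_sum, smul_eval, map_mul, eval_X, mul_assoc]

theorem matT_eval {w : Fin 4 → ℂ} {p : MvPolynomial (Fin 4) ℂ} {d : ℂ}
    (hp : eulerDerivation w p = d • p) (x : Fin 4 → ℂ) :
    matT w (fun x => eval x p) x = Matrix.of fun i j =>
      (d - w (Fin.rev j) - w i) / w 3 * eval x (pderiv i (pderiv (Fin.rev j) p)) := by
  ext i j
  simp only [matT, hessC, pd_eval, euler_eval, Matrix.of_apply, smul_eval,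
    eulerDerivation_pderiv (eulerDerivation_pderiv hp _)]
  ring

end PolynomialFunctions

section PolynomialPotential

/-- `potH4Zero` as a polynomial. -/
def polyPotH4Zero : MvPolynomial (Fin 4) ℂ :=
  C (1 / 2) * X 0 * X 3 ^ 2 + X 1 * X 2 * X 3 + C (32 / 22395255890625) * X 0 ^ 31 +
    C (2 / 15582375) * X 0 ^ 19 * X 1 ^ 2 + C (1 / 72900) * X 0 ^ 13 * X 1 ^ 3 +
    C (8 / 22275) * X 0 ^ 11 * X 2 ^ 2 + C (1 / 810) * X 0 ^ 9 * X 1 ^ 2 * X 2 +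
    C (1 / 1080) * X 0 ^ 7 * X 1 ^ 4 + C (1 / 15) * X 0 ^ 5 * X 1 * X 2 ^ 2 +
    C (1 / 18) * X 0 ^ 3 * X 1 ^ 3 * X 2 + C (1 / 240) * X 0 * X 1 ^ 5 +
    C (2 / 3) * X 0 * X 2 ^ 3

theorem potH4Zero_eq_eval : potH4Zero = fun x => eval x polyPotH4Zero := by
  funext x
  simp only [potH4Zero, polyPotH4Zero, map_add, map_mul, map_pow, eval_X, eval_C]
  ring

theorem eulerDerivation_polyPotH4Zero :
    eulerDerivation wH4Zero polyPotH4Zero = (31 / 15 : ℂ) • polyPotH4Zero := by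
  refine MvPolynomial.funext fun x => ?_
  simp only [polyPotH4Zero, map_add, Derivation.leibniz, Derivation.leibniz_pow, derivation_C,
    eulerDerivation_X, wH4Zero, Matrix.cons_val, smul_eval, map_mul, map_pow, smul_eq_mul,
    nsmul_eq_mul, map_natCast, map_zero, eval_C, eval_X]
  ring

/-- The Jacobian matrix of `coordH4Zero`: the rows are the images of `∂/∂t₁₅`, `∂/∂t₁₀`,
`1/5 ∂/∂t₆`, `1/5 ∂/∂t₁`, the vector fields that send `f` to the basis `1, y, σ, σy` of `mulN`. -/
def jacobianH4Zero (t : Fin 4 → ℂ) : Matrix (Fin 4) (Fin 4) ℂ :=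
  !![0, 0, 0, 144 / 15625;
    0, 0, -12 / 625, -16 / 3125 * t 0 ^ 5;
    0, -12 / 125, -2 / 125 * t 0 ^ 4, 48 / 3125 * t 0 ^ 3 * t 1 - 112 / 16875 * t 0 ^ 9;
    1 / 5, 16 / 75 * t 0 ^ 5, 16 / 405 * t 0 ^ 9 - 8 / 125 * t 0 ^ 3 * t 1,
      72 / 3125 * t 0 ^ 2 * t 1 ^ 2 - 16 / 3125 * t 0 ^ 4 * t 2 - 112 / 1875 * t 0 ^ 8 * t 1 +
        104 / 6075 * t 0 ^ 14]

theorem det_jacobianH4Zero (t : Fin 4 → ℂ) :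
    (jacobianH4Zero t).det = 20736 / 6103515625 := by
  simp only [det_fin_four, jacobianH4Zero, Matrix.of_apply, Matrix.cons_val]
  ring

theorem jacobianH4Zero_mul_matT (t : Fin 4 → ℂ) :
    jacobianH4Zero t * matT wH4Zero potH4Zero (coordH4Zero t) =
      (144 / 15625 : ℂ) • (mulN t * jacobianH4Zero t) := by
  rw [potH4Zero_eq_eval, matT_eval eulerDerivation_polyPotH4Zero]
  ext i j
  rw [Matrix.smul_apply, Matrix.mul_apply, Matrix.mul_apply, Fin.sum_univ_four, Fin.sum_univ_four]
  revert i j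
  simp only [Fin.forall_fin_succ, Fin.reduceSucc, IsEmpty.forall_iff, and_true,
    Fin.succ_zero_eq_one, jacobianH4Zero, mulN, mulY, mulS, Matrix.add_apply, Matrix.smul_apply,
    Matrix.mul_apply, Fin.sum_univ_four, Matrix.one_apply, Matrix.of_apply, Fin.reduceRev,
    polyPotH4Zero, map_add, Derivation.leibniz, Derivation.leibniz_pow, pderiv_C, pderiv_one,
    pderiv_X, pow_one, Pi.single_apply, Fin.reduceEq, if_true, if_false, smul_eq_mul, nsmul_eq_mul,
    Nat.cast_ofNat, Nat.reduceSub, map_mul, map_pow, map_zero, map_one, map_ofNat, derivation_ofNat,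
    mul_zero, zero_mul, add_zero, zero_add, mul_one, eval_C, eval_X, wH4Zero, coordH4Zero,
    Matrix.cons_val]
  refine ⟨⟨?_, ?_, ?_, ?_⟩, ⟨?_, ?_, ?_, ?_⟩, ⟨?_, ?_, ?_, ?_⟩, ⟨?_, ?_, ?_, ?_⟩⟩ <;> ring

theorem discr_potH4Zero (t : Fin 4 → ℂ) :
    discr wH4Zero potH4Zero (coordH4Zero t) =
      589824 / 59604644775390625 * eval t polyDH4Zero := by
  have hdet := congrArg Matrix.det (jacobianH4Zero_mul_matT t)
  rw [Matrix.det_mul, Matrix.det_smul, Matrix.det_mul, det_jacobianH4Zero,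
    Fintype.card_fin] at hdet
  rw [discr, eval_polyDH4Zero, ← det_mulN]
  linear_combination 6103515625 / 20736 * hdet

end PolynomialPotential

section AlgebraicPotential

/-- The equation `h` of the double cover `z² = h(x)`. -/
def coverPoly : MvPolynomial (Fin 4) ℂ :=
  X 2 + 4 * X 0 * (X 0 ^ 5 - 3 * X 1)

theorem eval_coverPoly (x : Fin 4 → ℂ) :
    eval x coverPoly = x 2 + 4 * x 0 * (x 0 ^ 5 - 3 * x 1) := by
  simp only [coverPoly, map_add, map_sub, map_mul, map_pow, map_ofNat, eval_X]

theorem eulerDerivation_coverPoly :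
    eulerDerivation wH4One coverPoly = (3 / 5 : ℂ) • coverPoly := by
  refine MvPolynomial.funext fun x => ?_
  simp only [coverPoly, map_add, map_sub, map_mul, map_pow, map_zero, map_natCast, map_ofNat,
    Derivation.leibniz, Derivation.leibniz_pow, derivation_ofNat, eulerDerivation_X, wH4One,
    Matrix.cons_val, smul_eval, smul_eq_mul, nsmul_eq_mul, eval_X]
  ring

theorem pd_congr {U : Set (Fin 4 → ℂ)} (hU : IsOpen U) {F G : (Fin 4 → ℂ) → ℂ}
    (h : Set.EqOn F G U) (j : Fin 4) : Set.EqOn (pd j F) (pd j G) U := fun x hx => by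
  simp only [pd, (Filter.eventuallyEq_of_mem (hU.mem_nhds hx) h).fderiv_eq]

theorem euler_congr {U : Set (Fin 4 → ℂ)} (hU : IsOpen U) {F G : (Fin 4 → ℂ) → ℂ}
    (h : Set.EqOn F G U) (w : Fin 4 → ℂ) : Set.EqOn (euler w F) (euler w G) U := fun x hx => by
  simp only [euler, pd_congr hU h _ hx]

namespace IsBranch

variable {U : Set (Fin 4 → ℂ)} {z : (Fin 4 → ℂ) → ℂ} {x : Fin 4 → ℂ}

theorem sq_eq (h : IsBranch U z) (hx : x ∈ U) : z x ^ 2 = eval x coverPoly := by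
  rw [eval_coverPoly]
  linear_combination h.2.2 x hx

theorem basePoint_eq (h : IsBranch U z) (hx : x ∈ U) : basePoint ![x 0, x 1, z x, x 3] = x := by
  ext k
  fin_cases k <;> simp [basePoint, h.sq_eq hx, eval_coverPoly]

theorem differentiableAt (h : IsBranch U z) (hx : x ∈ U) : DifferentiableAt ℂ z x :=
  h.2.1.differentiableAt (h.1.mem_nhds hx)

theorem two_mul_pd (h : IsBranch U z) (hx : x ∈ U) (j : Fin 4) :
    2 * z x * pd j z x = eval x (pderiv j coverPoly) := by
  have hpd := pd_congr h.1 (fun y hy => h.sq_eq hy) j hx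
  rw [pd_eval, pd, ((h.differentiableAt hx).hasFDerivAt.pow 2).fderiv] at hpd
  simpa [pd] using hpd

theorem pd_eval_add_pow_mul_eval (h : IsBranch U z) (n : ℕ) (p q : MvPolynomial (Fin 4) ℂ)
    (j : Fin 4) :
    Set.EqOn (pd j fun y => eval y p + z y ^ (n + 2) * eval y q)
      (fun y => eval y (pderiv j p) + z y ^ n *
        eval y (((n + 2) / 2 : ℂ) • (pderiv j coverPoly * q) + coverPoly * pderiv j q)) U := by
  intro x hx
  have hz := (h.differentiableAt hx).hasFDerivAt
  have hF := (hasFDerivAt_eval p x).fun_add ((hz.pow (n + 2)).fun_mul (hasFDerivAt_eval q x))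
  rw [pd, hF.fderiv]
  simp only [map_add, map_mul, smul_eval, ← h.two_mul_pd hx, ← h.sq_eq hx, pd]
  simp only [Nat.add_one_sub_one, nsmul_eq_mul, Nat.cast_add, Nat.cast_ofNat, add_apply, sum_apply,
    smul_apply, ContinuousLinearMap.proj_apply, Pi.single_apply, smul_eq_mul, mul_ite, mul_one,
    mul_zero, Finset.sum_ite_eq', Finset.mem_univ, if_true]
  ring

theorem euler_eval_add_pow_mul_eval (h : IsBranch U z) {w : Fin 4 → ℂ} {a b c : ℂ} {n : ℕ}
    {p q : MvPolynomial (Fin 4) ℂ} (hp : eulerDerivation w p = a • p)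
    (hq : eulerDerivation w q = b • q) (hcover : eulerDerivation w coverPoly = c • coverPoly)
    (hx : x ∈ U) :
    euler w (fun y => eval y p + z y ^ (n + 2) * eval y q) x =
      (a * eval x p + ((n + 2) / 2 * c + b) * (z x ^ (n + 2) * eval x q)) / w 3 := by
  have h_sum (r : MvPolynomial (Fin 4) ℂ) (d : ℂ) (hr : eulerDerivation w r = d • r) :
      ∑ k, w k * (x k * eval x (pderiv k r)) = d * eval x r := by
    simpa only [eulerDerivation_eq_sum, map_sum, smul_eval, map_mul, eval_X] using
      congrArg (eval x) hr
  rw [euler, one_div_mul_eq_div]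
  congr 1
  rw [pow_add, h.sq_eq hx]
  calc _ = ∑ k, (w k * (x k * eval x (pderiv k p)) + z x ^ n * ((n + 2) / 2 * eval x q *
        (w k * (x k * eval x (pderiv k coverPoly))) +
          eval x coverPoly * (w k * (x k * eval x (pderiv k q))))) := by
        refine Finset.sum_congr rfl fun k _ => ?_
        rw [h.pd_eval_add_pow_mul_eval n p q k hx]
        simp only [map_add, map_mul, smul_eval]
        ring
    _ = _ := by
        simp only [Finset.sum_add_distrib, ← Finset.mul_sum, h_sum _ _ hp, h_sum _ _ hq,
          h_sum _ _ hcover]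
        ring

end IsBranch

theorem exists_isBranch (s : Fin 4 → ℂ) (hs : s 2 ≠ 0) :
    ∃ (U : Set (Fin 4 → ℂ)) (z : (Fin 4 → ℂ) → ℂ),
      IsBranch U z ∧ basePoint s ∈ U ∧ z (basePoint s) = s 2 := by
  have hd : Differentiable ℂ fun x : Fin 4 → ℂ => eval x coverPoly / s 2 ^ 2 := fun x => by
    simpa only [div_eq_mul_inv] using
      (hasFDerivAt_eval coverPoly x).differentiableAt.mul_const ((s 2 ^ 2)⁻¹)
  have hbase : eval (basePoint s) coverPoly / s 2 ^ 2 = 1 := by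
    rw [div_eq_one_iff_eq (pow_ne_zero 2 hs), eval_coverPoly]
    simp [basePoint]
  refine ⟨{x | eval x coverPoly / s 2 ^ 2 ∈ Complex.slitPlane},
    fun x => s 2 * Complex.exp (2⁻¹ * Complex.log (eval x coverPoly / s 2 ^ 2)),
    ⟨Complex.isOpen_slitPlane.preimage hd.continuous, fun x hx => ?_, fun x hx => ?_⟩, ?_, ?_⟩
  · exact ((((hd x).clog hx).const_mul 2⁻¹).cexp.const_mul _).differentiableWithinAt
  · have hne : eval x coverPoly / s 2 ^ 2 ≠ 0 := Complex.slitPlane_ne_zero hx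
    rw [mul_pow, ← Complex.exp_nat_mul, Nat.cast_ofNat, mul_inv_cancel_left₀ two_ne_zero,
      Complex.exp_log hne, mul_div_cancel₀ _ (pow_ne_zero 2 hs), eval_coverPoly]
    ring
  · rw [Set.mem_ofPred_eq, hbase]
    exact Complex.one_mem_slitPlane
  · simp only [hbase, Complex.log_one, mul_zero, Complex.exp_zero, mul_one]

/-- The part of `potH4One` that remains polynomial in the flat coordinates when `z²` is replaced by
`coverPoly`: the potential is `regularPotH4One + z⁷ / 105`. -/
def regularPotH4One : MvPolynomial (Fin 4) ℂ :=
  X 1 * X 2 * X 3 - C (8 / 3) * X 1 ^ 3 * X 2 + C (1 / 2) * X 0 * X 3 ^ 2 +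
    C 28 * X 0 * X 1 ^ 4 + C (1 / 6) * X 0 ^ 3 * X 2 ^ 3 - X 0 ^ 4 * X 1 * X 2 ^ 2 +
    C 32 * X 0 ^ 5 * X 1 ^ 2 * X 2 + C (16 / 3) * X 0 ^ 6 * X 1 ^ 3 +
    C (19 / 18) * X 0 ^ 9 * X 2 ^ 2 + C 8 * X 0 ^ 10 * X 1 * X 2 +
    C (472 / 11) * X 0 ^ 11 * X 1 ^ 2 - C (16 / 15) * X 0 ^ 15 * X 2 +
    C (64 / 5) * X 0 ^ 16 * X 1 + C (3356 / 665) * X 0 ^ 21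

theorem eulerDerivation_regularPotH4One :
    eulerDerivation wH4One regularPotH4One = (21 / 10 : ℂ) • regularPotH4One := by
  refine MvPolynomial.funext fun x => ?_
  simp only [regularPotH4One, map_add, map_sub, Derivation.leibniz, Derivation.leibniz_pow,
    derivation_C, eulerDerivation_X, wH4One, Matrix.cons_val, smul_eval, map_mul, map_pow,
    smul_eq_mul, nsmul_eq_mul, map_natCast, map_zero, eval_C, eval_X]
  ring

theorem IsBranch.potH4One_eq {U : Set (Fin 4 → ℂ)} {z : (Fin 4 → ℂ) → ℂ} {x : Fin 4 → ℂ}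
    (h : IsBranch U z) (hx : x ∈ U) :
    potH4One z x = eval x regularPotH4One + z x ^ (5 + 2) * eval x (C (1 / 105)) := by
  have hpow (n : ℕ) : z x ^ (2 * n) = (x 2 + 4 * x 0 * (x 0 ^ 5 - 3 * x 1)) ^ n := by
    rw [pow_mul, h.sq_eq hx, eval_coverPoly]
  rw [potH4One, show z x ^ 2 = _ from hpow 1, show z x ^ 4 = _ from hpow 2,
    show z x ^ 6 = _ from hpow 3]
  simp only [regularPotH4One, map_add, map_sub, map_mul, map_pow, eval_C, eval_X]
  ring

/-- The coefficient of `z³` in the `(i, j)` entry of the Hessian matrix of `z⁷ / 105`. -/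
def hessPowSeven (i j : Fin 4) : MvPolynomial (Fin 4) ℂ :=
  (1 / 12 : ℂ) • (pderiv i coverPoly * pderiv j coverPoly) +
    (1 / 30 : ℂ) • (coverPoly * pderiv i (pderiv j coverPoly))

theorem eulerDerivation_hessPowSeven (i j : Fin 4) :
    eulerDerivation wH4One (hessPowSeven i j) =
      (6 / 5 - wH4One i - wH4One j : ℂ) • hessPowSeven i j := by
  have hi := eulerDerivation_pderiv eulerDerivation_coverPoly i
  have hj := eulerDerivation_pderiv eulerDerivation_coverPoly j
  have hij := eulerDerivation_pderiv hj i
  rw [hessPowSeven, map_add, Derivation.map_smul, Derivation.map_smul, eulerDerivation_mul hi hj,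
    eulerDerivation_mul eulerDerivation_coverPoly hij]
  module

theorem IsBranch.hessC_potH4One {U : Set (Fin 4 → ℂ)} {z : (Fin 4 → ℂ) → ℂ} (h : IsBranch U z)
    (i j : Fin 4) :
    Set.EqOn (hessC (potH4One z) i j)
      (fun y => eval y (pderiv i (pderiv (Fin.rev j) regularPotH4One)) +
        z y ^ (1 + 2) * eval y (hessPowSeven i (Fin.rev j))) U := by
  have hfirst := (pd_congr h.1 (fun y hy => h.potH4One_eq hy) (Fin.rev j)).trans
    (h.pd_eval_add_pow_mul_eval 5 _ _ (Fin.rev j))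
  intro x hx
  rw [hessC, pd_congr h.1 hfirst i hx, h.pd_eval_add_pow_mul_eval 3 _ _ i hx]
  simp only [hessPowSeven, map_add, map_mul, Derivation.map_smul, smul_eval, Derivation.leibniz,
    pderiv_C, smul_eq_mul, eval_C, mul_zero, zero_add, add_zero]
  ring

theorem IsBranch.matT_potH4One {U : Set (Fin 4 → ℂ)} {z : (Fin 4 → ℂ) → ℂ} {x : Fin 4 → ℂ}
    (h : IsBranch U z) (hx : x ∈ U) (i j : Fin 4) :
    matT wH4One (potH4One z) x i j = (21 / 10 - wH4One i - wH4One (Fin.rev j)) *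
      (eval x (pderiv i (pderiv (Fin.rev j) regularPotH4One)) +
        z x ^ 3 * eval x (hessPowSeven i (Fin.rev j))) := by
  rw [matT, Matrix.of_apply, euler_congr h.1 (h.hessC_potH4One i j) _ hx,
    h.euler_eval_add_pow_mul_eval
      (eulerDerivation_pderiv (eulerDerivation_pderiv eulerDerivation_regularPotH4One _) _)
      (eulerDerivation_hessPowSeven _ _) eulerDerivation_coverPoly hx]
  simp only [wH4One, Matrix.cons_val, Nat.cast_one]
  ring

/-- `basePoint` as a vector of polynomials in `(x₁, x₂, z, x₄)`. -/
def basePolys : Fin 4 → MvPolynomial (Fin 4) ℂ :=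
  ![X 0, X 1, X 2 ^ 2 - 4 * X 0 * (X 0 ^ 5 - 3 * X 1), X 3]

theorem eval_bind₁_basePolys (s : Fin 4 → ℂ) (p : MvPolynomial (Fin 4) ℂ) :
    eval s (bind₁ basePolys p) = eval (basePoint s) p := by
  rw [eval_bind₁]
  congr 2
  ext k
  fin_cases k <;> simp [basePolys, basePoint]

/-- The matrix `T` of `potH4One` as a matrix of polynomials in `(x₁, x₂, z, x₄)`. -/
def polyMatTH4One : Matrix (Fin 4) (Fin 4) (MvPolynomial (Fin 4) ℂ) :=
  Matrix.of fun i j => C (21 / 10 - wH4One i - wH4One (Fin.rev j)) *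
    (bind₁ basePolys (pderiv i (pderiv (Fin.rev j) regularPotH4One)) +
      X 2 ^ 3 * bind₁ basePolys (hessPowSeven i (Fin.rev j)))

theorem eval_polyMatTH4One (s : Fin 4 → ℂ) (i j : Fin 4) :
    eval s (polyMatTH4One i j) = (21 / 10 - wH4One i - wH4One (Fin.rev j)) *
      (eval (basePoint s) (pderiv i (pderiv (Fin.rev j) regularPotH4One)) +
        s 2 ^ 3 * eval (basePoint s) (hessPowSeven i (Fin.rev j))) := by
  simp only [polyMatTH4One, Matrix.of_apply, map_mul, map_add, map_pow, eval_C, eval_X,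
    eval_bind₁_basePolys]

theorem IsBranch.discr_potH4One {U : Set (Fin 4 → ℂ)} {z : (Fin 4 → ℂ) → ℂ} {x : Fin 4 → ℂ}
    (h : IsBranch U z) (hx : x ∈ U) :
    discr wH4One (potH4One z) x = eval ![x 0, x 1, z x, x 3] polyMatTH4One.det := by
  rw [RingHom.map_det, discr]
  congr 1
  ext i j
  rw [h.matT_potH4One hx, RingHom.mapMatrix_apply, Matrix.map_apply, eval_polyMatTH4One,
    h.basePoint_eq hx]
  rfl

theorem eval_coordH4One_det_polyMatTH4One (t : Fin 4 → ℂ) :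
    eval (coordH4One t) polyMatTH4One.det = 17592186044416 / 625 * eval t polyDH4One := by
  rw [RingHom.map_det, det_fin_four, eval_polyDH4One]
  simp only [RingHom.mapMatrix_apply, Matrix.map_apply, eval_polyMatTH4One]
  simp only [regularPotH4One, hessPowSeven, coverPoly, map_add, map_sub, map_mul, map_pow,
    Derivation.leibniz, Derivation.leibniz_pow, Fin.reduceRev, pderiv_C, pderiv_one,
    derivation_ofNat, pderiv_X, pow_one, Pi.single_apply, Fin.reduceEq, if_true, if_false,
    smul_eq_mul, nsmul_eq_mul, Nat.cast_ofNat, Nat.reduceSub, map_zero, map_one, map_ofNat,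
    smul_eval, mul_zero, zero_mul, add_zero, zero_add, sub_zero, mul_one, eval_C, eval_X, wH4One,
    coordH4One, basePoint, exprDH4One, Matrix.cons_val]
  ring

end AlgebraicPotential

end H4Family

end

theorem mainTheorem5 :
    -- the family `H₄(0)` and the polynomial potential
    (IsDiscriminant fH4Zero polyDH4Zero ∧
      Function.Bijective coordH4Zero ∧
      ∃ c : ℂ, c ≠ 0 ∧ ∀ t : Fin 4 → ℂ,
        discr wH4Zero potH4Zero (coordH4Zero t) = c * eval t polyDH4Zero) ∧
    -- the family `H₄(1)` and the algebraic potential, whose `det T` is a polynomial `Δ` in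
    -- `(x₁, x₂, z, x₄)`; branches of `z` exist at all points with `z ≠ 0`
    (IsDiscriminant fH4One (X 3 * polyDH4One) ∧
      Function.Bijective coordH4One ∧
      (∀ s : Fin 4 → ℂ, s 2 ≠ 0 →
        ∃ (U : Set (Fin 4 → ℂ)) (z : (Fin 4 → ℂ) → ℂ),
          IsBranch U z ∧ basePoint s ∈ U ∧ z (basePoint s) = s 2) ∧
      ∃ Δ : MvPolynomial (Fin 4) ℂ,
        (∀ (U : Set (Fin 4 → ℂ)) (z : (Fin 4 → ℂ) → ℂ), IsBranch U z →
          ∀ x ∈ U, discr wH4One (potH4One z) x = eval ![x 0, x 1, z x, x 3] Δ) ∧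
        ∃ c : ℂ, c ≠ 0 ∧ ∀ t : Fin 4 → ℂ, eval (coordH4One t) Δ = c * eval t polyDH4One) ∧
    -- the two families and their discriminants are related by the substitution `t ↦ u`
    (∀ t : Fin 4 → ℂ,
      bind₁ ![X 0 - C (2 * t 1), X 1 + C (1 / 3 * (10 * t 0 ^ 2 * t 1 - t 2))] (fH4One t) =
          fH4Zero (substU t) ∧
        eval (substU t) polyDH4Zero = t 3 ^ 2 * eval t polyDH4One) := by
  refine ⟨⟨isDiscriminant_fH4Zero, bijective_coordH4Zero, _, ?_, discr_potH4Zero⟩,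
    ⟨isDiscriminant_fH4One, bijective_coordH4One, exists_isBranch, polyMatTH4One.det,
      fun _ _ h _ hx => h.discr_potH4One hx, _, ?_, eval_coordH4One_det_polyMatTH4One⟩,
    fun t => ⟨bind₁_fH4One t, eval_substU_polyDH4Zero t⟩⟩ <;> norm_num
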